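/- For a finite positive Borel measure $\rho$ on the unit circle $\mathbb T=\{t\in\mathbb C:|t|=1\}$ and an integer $n\ge 0$, let $e_n(\rho)\ge 0$ be defined by \[ e_n(\rho)^2=\min_{q_0,\dots,q_{n-1}\in\mathbb C}\int_{\mathbb T}\bigl|t^n+q_{n-1}t^{n-1}+\dots+q_1t+q_0\bigr|^2\,d\rho(t). \] For a sequence $a=(a_j)_{j\ge 1}$ of positive numbers with $\sum_{j\ge1}a_j=1$, put \[ e_n^*(a)=\sup_{(\lambda_j)_{j\ge1}\subset\mathbb T}\,e_n\Bigl(\sum_{j\ge1}a_j\delta_{\lambda_j}\Bigr),\qquad s_k=\sum_{j>k}a_j\quad(k\ge 0). \] (i) If $a_1\ge a_2\ge\cdots$, then for every $n\ge0$, \[ e_n^*(a)^2\ge (n+1)\sum_{j\ge1}a_{j(n+1)}; \] in particular, $e_n^*(a)^2\ge (n+1)a_{n+1}$. (ii) For every $\gamma\in(0,1)$ and every $A>0$ there is a constant $C=C(\gamma,A)>0$ such that, for all sequences $a$ as above and all integers $n,k\ge0$, \[ k\,|\log s_k|^{1+\frac1\gamma}\le A\,n\quad\Longrightarrow\quad e_n^*(a)^2\le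 C\,s_k. \] (iii) For every $\sigma\in(0,\tfrac12]$, all sequences $a$ as above and all integers $0\le k\le n$, \[ k^2\,|\log s_k|^{-1}\le\tfrac18\sigma n\quad\Longrightarrow\quad e_n^*(a)^2\le s_k^{1-\sigma} \] (for $k=0$ the left-hand side of the hypothesis is read as $0$). -/

import Mathlib

open MeasureTheory

noncomputable section

namespace SzegoMinimum

/-- The unit circle carries its Borel sigma-algebra. -/
instance instMeasurableSpaceCircle : MeasurableSpace Circle := borel Circle

instance instBorelSpaceCircle : BorelSpace Circle := ⟨rfl⟩

/-- The quantity `e_n(ρ)`, given by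
`e_n(ρ)² = min_{q_0, …, q_{n-1} ∈ ℂ} ∫_𝕋 |t^n + q_{n-1} t^{n-1} + ⋯ + q_0|² dρ(t)`. -/
def e (n : ℕ) (ρ : Measure Circle) : ℝ :=
  Real.sqrt (⨅ q : Fin n → ℂ,
    ∫ t : Circle, ‖(t : ℂ) ^ n + ∑ i : Fin n, q i * (t : ℂ) ^ (i : ℕ)‖ ^ 2 ∂ρ)

/-- A sequence of weights: positive numbers `a_1, a_2, …` with sum `1`. -/
structure IsWeightSeq (a : ℕ+ → ℝ) : Prop where
  pos : ∀ j, 0 < a j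
  hasSum : HasSum a 1

/-- The discrete measure `∑_{j ≥ 1} a_j δ_{z_j}` on the unit circle. -/
def discreteMeasure (a : ℕ+ → ℝ) (z : ℕ+ → Circle) : Measure Circle :=
  Measure.sum fun j => ENNReal.ofReal (a j) • Measure.dirac (z j)

/-- `e*_n(a)`, the supremum of `e_n(∑ a_j δ_{z_j})` over all sequences of points of the circle
(repetitions allowed). -/
def eStar (n : ℕ) (a : ℕ+ → ℝ) : ℝ :=
  ⨆ z : ℕ+ → Circle, e n (discreteMeasure a z)

/-- The tail sum `s_k = ∑_{j > k} a_j = a_{k+1} + a_{k+2} + ⋯`. -/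
def tail (a : ℕ+ → ℝ) (k : ℕ) : ℝ :=
  ∑' i : ℕ, a (Nat.succPNat (k + i))

lemma isProbabilityMeasure_discreteMeasure {a : ℕ+ → ℝ} (ha : IsWeightSeq a)
    (z : ℕ+ → Circle) : IsProbabilityMeasure (discreteMeasure a z) := by
  constructor
  simp only [discreteMeasure, Measure.sum_apply _ MeasurableSet.univ, Measure.smul_apply,
    measure_univ, smul_eq_mul, mul_one]
  rw [← ENNReal.ofReal_tsum_of_nonneg (fun j => (ha.pos j).le) ha.hasSum.summable,
    ha.hasSum.tsum_eq, ENNReal.ofReal_one]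

lemma e_le_one (n : ℕ) (ρ : Measure Circle) [IsProbabilityMeasure ρ] : e n ρ ≤ 1 := by
  refine Real.sqrt_le_one.2 ((ciInf_le ⟨0, ?_⟩ 0).trans ?_)
  · rintro _ ⟨q, rfl⟩
    exact integral_nonneg fun t => by positivity
  · simp [Circle.norm_coe]

/-- The supremum defining `eStar` is a genuine one. -/
lemma bddAbove_range_e (n : ℕ) {a : ℕ+ → ℝ} (ha : IsWeightSeq a) :
    BddAbove (Set.range fun z : ℕ+ → Circle => e n (discreteMeasure a z)) := by
  refine ⟨1, ?_⟩
  rintro _ ⟨z, rfl⟩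
  have := isProbabilityMeasure_discreteMeasure ha z
  exact e_le_one n _

end SzegoMinimum

end

noncomputable section

namespace SzegoMinimum

/-! Lower bound. Put the points at powers of a primitive `(n+1)`-st root of unity. A monic
polynomial of degree `n` has mean square at least `1` over these roots, and by monotonicity of the
weights every residue class carries at least the mass of the class of `0`.

Upper bounds. Passing to reciprocal polynomials, one may use any `P` of degree at most `n` with
`P(0) = 1`. If `|P|² ≤ M` on the circle and `|P|² ≤ η` at the `k` points carrying the weights `a_1,
…, a_k`, then the integral is at most `η + M s_k` (`eStar_sq_le_of_polynomials`).

For (iii), `η = 0`: `P` is a product of `k` rotated Halász polynomials of degree at most `⌊n/k⌋`,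
each vanishing at one point and barely exceeding `1` on the circle (`exists_halaszPoly`).

For (ii), exact zeros are too expensive; `η` comparable to `s_k` is enough. An outer function
bounded by `e^A` on a disc slightly larger than the unit disc is made small at the points by
Herglotz kernels (`exists_analytic_small_at`), then replaced by a polynomial with an exponentially
small error (`exists_polynomial_approx`). The radius is chosen so that both errors are at most of
order `s_k`. -/

/-! ### Discrete measures, tails and the reduction to test polynomials -/

lemma integral_discreteMeasure {a : ℕ+ → ℝ} (ha : IsWeightSeq a) (z : ℕ+ → Circle)
    {f : Circle → ℝ} (hf : Continuous f) :
    HasSum (fun j => a j * f (z j)) (∫ t, f t ∂(discreteMeasure a z)) := by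
  have := isProbabilityMeasure_discreteMeasure ha z
  obtain ⟨C, hC⟩ := isCompact_univ.exists_bound_of_continuousOn hf.continuousOn
  have hint : Integrable f (discreteMeasure a z) :=
    Integrable.of_bound hf.aestronglyMeasurable C (.of_forall fun t => hC t trivial)
  have h := hasSum_integral_measure (f := f) hint
  have he : (fun j => a j * f (z j)) =
      fun j => ∫ t, f t ∂(ENNReal.ofReal (a j) • Measure.dirac (z j)) := by
    funext j
    simp [integral_smul_measure, integral_dirac, ENNReal.toReal_ofReal (ha.pos j).le]
  rw [he]
  exact h

lemma e_sq (n : ℕ) (ρ : Measure Circle) :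
    e n ρ ^ 2 = ⨅ q : Fin n → ℂ,
      ∫ t : Circle, ‖(t : ℂ) ^ n + ∑ i : Fin n, q i * (t : ℂ) ^ (i : ℕ)‖ ^ 2 ∂ρ :=
  Real.sq_sqrt (Real.iInf_nonneg fun _ => integral_nonneg fun _ => by positivity)

lemma eStar_nonneg (n : ℕ) (a : ℕ+ → ℝ) : 0 ≤ eStar n a :=
  Real.iSup_nonneg fun _ => Real.sqrt_nonneg _

lemma eStar_sq_le_of_forall {n : ℕ} {a : ℕ+ → ℝ} {C : ℝ} (hC : 0 ≤ C)
    (h : ∀ z, e n (discreteMeasure a z) ^ 2 ≤ C) : eStar n a ^ 2 ≤ C := by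
  refine (Real.le_sqrt (eStar_nonneg n a) hC).1 (ciSup_le fun z => ?_)
  exact Real.le_sqrt_of_sq_le (h z)

lemma e_sq_le_eStar_sq {n : ℕ} {a : ℕ+ → ℝ} (ha : IsWeightSeq a) (z : ℕ+ → Circle) :
    e n (discreteMeasure a z) ^ 2 ≤ eStar n a ^ 2 :=
  pow_le_pow_left₀ (Real.sqrt_nonneg _) (le_ciSup (bddAbove_range_e n ha) z) 2

lemma eStar_sq_le_one {n : ℕ} {a : ℕ+ → ℝ} (ha : IsWeightSeq a) : eStar n a ^ 2 ≤ 1 := by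
  refine eStar_sq_le_of_forall zero_le_one fun z => ?_
  have := isProbabilityMeasure_discreteMeasure ha z
  exact pow_le_one₀ (Real.sqrt_nonneg _) (e_le_one n _)

/-- A polynomial with constant term `1` bounds `e n ρ`, by passing to the reciprocal polynomial. -/
lemma e_sq_le_integral {n : ℕ} (ρ : Measure Circle) {P : Polynomial ℂ}
    (hn : P.natDegree ≤ n) (h0 : P.coeff 0 = 1) :
    e n ρ ^ 2 ≤ ∫ t : Circle, ‖P.eval ((t⁻¹ : Circle) : ℂ)‖ ^ 2 ∂ρ := by
  rw [e_sq]
  refine (ciInf_le ⟨0, ?_⟩ fun i : Fin n => P.coeff (n - i)).trans (le_of_eq ?_)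
  · rintro _ ⟨q, rfl⟩
    exact integral_nonneg fun t => by positivity
  refine integral_congr_ae (.of_forall fun t => ?_)
  have ht : (t : ℂ) ≠ 0 := t.coe_ne_zero
  have key : (t : ℂ) ^ n + ∑ i : Fin n, P.coeff (n - i) * (t : ℂ) ^ (i : ℕ)
      = (t : ℂ) ^ n * P.eval ((t⁻¹ : Circle) : ℂ) := by
    rw [Polynomial.eval_eq_sum_range' (Nat.lt_succ_of_le hn), Finset.mul_sum,
      ← Finset.sum_range_reflect, Finset.sum_range_succ]
    rw [Fin.sum_univ_eq_sum_range (fun i => P.coeff (n - i) * (t : ℂ) ^ i), add_comm]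
    congr 1
    · refine Finset.sum_congr rfl fun i hi => ?_
      have hi : i < n := Finset.mem_range.1 hi
      have h1 : n.succ - 1 - i = n - i := rfl
      have h2 : (t : ℂ) ^ n = (t : ℂ) ^ i * (t : ℂ) ^ (n - i) := by
        rw [← pow_add]; congr 1; omega
      rw [h1, h2, Circle.coe_inv, inv_pow]
      field_simp
    · simp [h0]
  simp only [key, norm_mul, norm_pow, Circle.norm_coe, one_pow, one_mul]

lemma tail_add_sum {a : ℕ+ → ℝ} (ha : IsWeightSeq a) (k : ℕ) :
    HasSum (fun i : ℕ => a (Nat.succPNat (k + i))) (tail a k) ∧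
    ∑ i ∈ Finset.range k, a (Nat.succPNat i) + tail a k = 1 := by
  have h : HasSum (fun i : ℕ => a (Nat.succPNat i)) 1 :=
    (Equiv.pnatEquivNat.symm.hasSum_iff (f := a)).2 ha.hasSum
  have hs : Summable fun i : ℕ => a (Nat.succPNat (k + i)) := by
    simpa [add_comm] using (summable_nat_add_iff k).2 h.summable
  refine ⟨hs.hasSum, ?_⟩
  rw [← h.tsum_eq, ← h.summable.sum_add_tsum_nat_add k, tail]
  simp only [add_comm k]

lemma tail_pos {a : ℕ+ → ℝ} (ha : IsWeightSeq a) (k : ℕ) : 0 < tail a k :=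
  (tail_add_sum ha k).1.summable.tsum_pos (fun _ => (ha.pos _).le) 0 (ha.pos _)

lemma tail_le_one {a : ℕ+ → ℝ} (ha : IsWeightSeq a) (k : ℕ) : tail a k ≤ 1 := by
  have := (tail_add_sum ha k).2
  have := Finset.sum_nonneg fun i (_ : i ∈ Finset.range k) => (ha.pos (Nat.succPNat i)).le
  linarith

lemma tail_lt_one {a : ℕ+ → ℝ} (ha : IsWeightSeq a) {k : ℕ} (hk : k ≠ 0) : tail a k < 1 := by
  have := (tail_add_sum ha k).2
  have := Finset.sum_pos (fun i (_ : i ∈ Finset.range k) => ha.pos (Nat.succPNat i))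
    (by simpa using hk)
  linarith

/-- The first `k` atoms have total mass at most `1` and contribute at most `η`; the others have mass
`s_k` and contribute at most `M s_k`. -/
lemma eStar_sq_le_of_polynomials {a : ℕ+ → ℝ} (ha : IsWeightSeq a) {n k : ℕ} {η M : ℝ}
    (hη : 0 ≤ η) (hM : 0 ≤ M)
    (h : ∀ z : ℕ → Circle, ∃ P : Polynomial ℂ, P.natDegree ≤ n ∧ P.coeff 0 = 1 ∧
      (∀ t : Circle, ‖P.eval (t : ℂ)‖ ^ 2 ≤ M) ∧ ∀ i < k, ‖P.eval (z i : ℂ)‖ ^ 2 ≤ η) :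
    eStar n a ^ 2 ≤ η + M * tail a k := by
  refine eStar_sq_le_of_forall
    (add_nonneg hη (mul_nonneg hM (tail_pos ha k).le)) fun z => ?_
  -- The points are inverted because the reciprocal polynomial evaluates `P` at `t⁻¹`.
  obtain ⟨P, hn, h0, hPM, hPη⟩ := h fun i => (z (Nat.succPNat i))⁻¹
  refine (e_sq_le_integral _ hn h0).trans ?_
  have hc : Continuous fun t : Circle => ‖P.eval ((t⁻¹ : Circle) : ℂ)‖ ^ 2 := by fun_prop
  have hs := (Equiv.pnatEquivNat.symm.hasSum_iff).2 (integral_discreteMeasure ha z hc)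
  rw [← hs.tsum_eq, ← hs.summable.sum_add_tsum_nat_add k]
  obtain ⟨ht, ht1⟩ := tail_add_sum ha k
  have hsum : ∑ i ∈ Finset.range k, a (Nat.succPNat i) ≤ 1 := by
    linarith [tail_pos ha k]
  refine add_le_add ?_ ?_
  · calc _ ≤ ∑ i ∈ Finset.range k, a (Nat.succPNat i) * η :=
          Finset.sum_le_sum fun i hi =>
            mul_le_mul_of_nonneg_left (hPη i (Finset.mem_range.1 hi)) (ha.pos _).le
      _ = (∑ i ∈ Finset.range k, a (Nat.succPNat i)) * η := by rw [Finset.sum_mul]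
      _ ≤ η := mul_le_of_le_one_left hη hsum
  · rw [← (ht.mul_left M).tsum_eq]
    refine Summable.tsum_le_tsum (fun i => ?_) ((summable_nat_add_iff k).2 hs.summable)
      (ht.mul_left M).summable
    rw [mul_comm M, add_comm k]
    exact mul_le_mul_of_nonneg_left (hPM _) (ha.pos _).le

/-! ### Lower bound: roots of unity -/

/-- The class of `0` modulo `n + 1` carries the least weight among the residue classes. -/
lemma tsum_mul_le_tsum_residue {a : ℕ+ → ℝ} (ha : IsWeightSeq a) (hanti : Antitone a)
    (n : ℕ) (F : ℕ → ℝ) (hF : ∀ j, 0 ≤ F j) (hper : ∀ i r, F (r + (n + 1) * i) = F r)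
    (hsum : Summable fun i : ℕ => a (Nat.succPNat i) * F i) :
    (∑ r ∈ Finset.range (n + 1), F r) * ∑' j : ℕ+, a (j * Nat.succPNat n)
      ≤ ∑' i : ℕ, a (Nat.succPNat i) * F i := by
  have hS : Summable fun i : ℕ => a (Nat.succPNat i * Nat.succPNat n) :=
    ha.hasSum.summable.comp_injective fun i j h => by simpa using h
  have e1 : ∑' j : ℕ+, a (j * Nat.succPNat n)
      = ∑' i : ℕ, a (Nat.succPNat i * Nat.succPNat n) :=
    (Equiv.pnatEquivNat.symm.tsum_eq fun j => a (j * Nat.succPNat n)).symm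
  have hsum' := (Nat.divModEquiv (n + 1)).symm.summable_iff.2 hsum
  have e2 := (Nat.divModEquiv (n + 1)).symm.tsum_eq fun i : ℕ => a (Nat.succPNat i) * F i
  have e3 := hsum'.tsum_prod
  simp only [Function.comp_apply] at e3
  rw [e1, ← e2, e3, ← tsum_mul_left]
  refine Summable.tsum_le_tsum (fun q => ?_) (hS.mul_left _) hsum'.prod
  rw [tsum_fintype, ← Fin.sum_univ_eq_sum_range, Finset.sum_mul]
  refine Finset.sum_le_sum fun r _ => ?_
  have hi : (Nat.divModEquiv (n + 1)).symm (q, r) = q * (n + 1) + r := rfl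
  have hFr : F (q * (n + 1) + r) = F r := by
    rw [← hper q r, add_comm, mul_comm]
  rw [hi, hFr, mul_comm]
  -- The weight here has index `q(n+1) + r + 1` with `r ≤ n`, hence at most `(q+1)(n+1)`.
  refine mul_le_mul_of_nonneg_right (hanti ?_) (hF _)
  rw [← PNat.coe_le_coe]
  have := r.2
  simp only [Nat.succPNat_coe, PNat.mul_coe, Nat.succ_eq_add_one]
  nlinarith

lemma exists_circle_primitiveRoot (n : ℕ) :
    ∃ w : Circle, IsPrimitiveRoot (w : ℂ) (n + 1) := by
  have h := Complex.isPrimitiveRoot_exp (n + 1) n.succ_ne_zero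
  refine ⟨⟨_, mem_sphere_zero_iff_norm.2 (h.norm'_eq_one n.succ_ne_zero)⟩, h⟩

/-- A monic polynomial of degree `n` has mean square at least `1` over the `(n+1)`-st roots of
unity. -/
lemma le_sum_norm_sq_rootsOfUnity {n : ℕ} {w : ℂ} (hw : IsPrimitiveRoot w (n + 1))
    (q : Fin n → ℂ) :
    (n : ℝ) + 1 ≤ ∑ r ∈ Finset.range (n + 1),
      ‖(w ^ (r + 1)) ^ n + ∑ i : Fin n, q i * (w ^ (r + 1)) ^ (i : ℕ)‖ ^ 2 := by
  set p : ℕ → ℂ := fun r => (w ^ (r + 1)) ^ n + ∑ i : Fin n, q i * (w ^ (r + 1)) ^ (i : ℕ)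
  have hw1 : ‖w‖ = 1 := hw.norm'_eq_one n.succ_ne_zero
  -- The extra factor moves the exponents from `0, …, n` to `1, …, n+1`; only the top one is a
  -- multiple of `n+1`, so the unknown coefficients drop out.
  have hsum : ∑ r ∈ Finset.range (n + 1), w ^ (r + 1) * p r = n + 1 := by
    have hzero : ∀ i : Fin n, ∑ r ∈ Finset.range (n + 1), (w ^ (r + 1)) ^ ((i : ℕ) + 1) = 0 := by
      intro i
      have h1 : w ^ ((i : ℕ) + 1) ≠ 1 :=
        hw.pow_ne_one_of_pos_of_lt (Nat.succ_ne_zero _) (by have := i.2; omega)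
      have h2 : (w ^ ((i : ℕ) + 1)) ^ (n + 1) = 1 := by
        rw [← pow_mul, mul_comm, pow_mul, hw.pow_eq_one, one_pow]
      have h3 : ∀ r, (w ^ (r + 1)) ^ ((i : ℕ) + 1) = w ^ ((i : ℕ) + 1) * (w ^ ((i : ℕ) + 1)) ^ r := by
        intro r; ring
      simp only [h3]
      rw [← Finset.mul_sum, geom_sum_eq h1, h2, sub_self, zero_div, mul_zero]
    have hone : ∀ r, (w ^ (r + 1)) ^ (n + 1) = 1 := by
      intro r
      rw [← pow_mul, mul_comm, pow_mul, hw.pow_eq_one, one_pow]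
    have hp : ∀ r, w ^ (r + 1) * p r
        = 1 + ∑ i : Fin n, q i * (w ^ (r + 1)) ^ ((i : ℕ) + 1) := by
      intro r
      simp only [p, mul_add, Finset.mul_sum]
      rw [← hone r]
      congr 1
      · ring
      · refine Finset.sum_congr rfl fun i _ => by ring
    simp only [hp]
    rw [Finset.sum_add_distrib, Finset.sum_comm]
    simp [← Finset.mul_sum, hzero]
  have h1 : (n : ℝ) + 1 ≤ ∑ r ∈ Finset.range (n + 1), ‖p r‖ := by
    calc (n : ℝ) + 1 = ‖((n : ℂ) + 1)‖ := by
          rw [show (n : ℂ) + 1 = ((n + 1 : ℕ) : ℂ) by push_cast; rfl, Complex.norm_natCast]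
          push_cast; rfl
      _ ≤ ∑ r ∈ Finset.range (n + 1), ‖w ^ (r + 1) * p r‖ := hsum ▸ norm_sum_le _ _
      _ = _ := by simp [hw1]
  have h2 := sq_sum_le_card_mul_sum_sq (s := Finset.range (n + 1)) (f := fun r => ‖p r‖)
  rw [Finset.card_range] at h2
  push_cast at h2
  have h3 : (0 : ℝ) < n + 1 := by positivity
  nlinarith

theorem le_eStar_sq_of_antitone {a : ℕ+ → ℝ} (ha : IsWeightSeq a) (hanti : Antitone a) (n : ℕ) :
    ((n : ℝ) + 1) * ∑' j : ℕ+, a (j * Nat.succPNat n) ≤ eStar n a ^ 2 := by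
  obtain ⟨w, hw⟩ := exists_circle_primitiveRoot n
  refine le_trans ?_ (e_sq_le_eStar_sq ha fun j => w ^ (j : ℕ))
  rw [e_sq]
  refine le_ciInf fun q => ?_
  set f : Circle → ℝ := fun t => ‖(t : ℂ) ^ n + ∑ i : Fin n, q i * (t : ℂ) ^ (i : ℕ)‖ ^ 2
  have hf : Continuous f := by fun_prop
  have hs := (Equiv.pnatEquivNat.symm.hasSum_iff).2
    (integral_discreteMeasure ha (fun j => w ^ (j : ℕ)) hf)
  rw [← hs.tsum_eq]
  refine le_trans ?_ (tsum_mul_le_tsum_residue ha hanti n (fun i => f (w ^ (i + 1)))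
    (fun j => by positivity) (fun i r => ?_) hs.summable)
  · refine mul_le_mul_of_nonneg_right ?_ (tsum_nonneg fun j => (ha.pos _).le)
    simpa [f] using le_sum_norm_sq_rootsOfUnity hw q
  · have : w ^ (n + 1) = 1 := by
      ext; simpa using hw.pow_eq_one
    rw [show r + (n + 1) * i + 1 = r + 1 + (n + 1) * i by ring, pow_add, pow_mul, this, one_pow,
      mul_one]

lemma le_tsum_multiples {a : ℕ+ → ℝ} (ha : IsWeightSeq a) (m : ℕ+) :
    a m ≤ ∑' j : ℕ+, a (j * m) := by
  have hS : Summable fun j : ℕ+ => a (j * m) :=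
    ha.hasSum.summable.comp_injective fun i j h => by simpa using h
  simpa using hS.le_tsum 1 fun j _ => (ha.pos _).le

/-! ### Halász polynomials and the bound with exact zeros -/

open Polynomial in
/-- The polynomials `z^{n/2} (T_n(x) - i α s U_{n-1}(x))` in `z = (c + i s)²`, where `x = α c`. -/
def halaszPoly (α : ℝ) : ℕ → ℂ[X]
  | 0 => 1
  | 1 => C (α : ℂ)
  | n + 2 => C (α : ℂ) * (1 + X) * halaszPoly α (n + 1) - X * halaszPoly α n

/-- Index `1` is already a constant, so the degree stays one below the index. -/
lemma natDegree_halaszPoly_succ_le (α : ℝ) (n : ℕ) : (halaszPoly α (n + 1)).natDegree ≤ n := by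
  induction n using Nat.strong_induction_on with
  | _ n ih =>
    match n with
    | 0 => simp [halaszPoly]
    | n + 1 =>
      rw [halaszPoly]
      refine (Polynomial.natDegree_sub_le _ _).trans (max_le ?_ ?_)
      · have h1 : (Polynomial.C (α : ℂ) * (1 + Polynomial.X)).natDegree ≤ 1 := by
          compute_degree
        exact Polynomial.natDegree_mul_le.trans (by have := ih n (by omega); omega)
      · refine Polynomial.natDegree_mul_le.trans ?_
        rw [Polynomial.natDegree_X]
        match n with
        | 0 => simp [halaszPoly]
        | n + 1 => have := ih n (by omega); omega

lemma coeff_zero_halaszPoly (α : ℝ) (n : ℕ) : (halaszPoly α n).coeff 0 = (α : ℂ) ^ n := by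
  induction n using Nat.twoStepInduction with
  | zero => simp [halaszPoly]
  | one => simp [halaszPoly]
  | more n _ h1 =>
    rw [halaszPoly]
    simp only [Polynomial.coeff_sub, Polynomial.mul_coeff_zero, Polynomial.coeff_X_zero, h1,
      Polynomial.coeff_C_zero, Polynomial.coeff_add, Polynomial.coeff_one_zero]
    ring

-- Since `1 + w² = 2 (Re w) w` on the circle, the recursion is the Chebyshev one multiplied by
-- powers of `w`.
open Polynomial.Chebyshev in
lemma eval_halaszPoly (α : ℝ) {w : ℂ} (hw : ‖w‖ = 1) (n : ℕ) :
    (halaszPoly α n).eval (w ^ 2) = w ^ n * (((T ℝ n).eval (α * w.re) : ℝ)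
      - Complex.I * ((α * w.im * (U ℝ ((n : ℤ) - 1)).eval (α * w.re) : ℝ) : ℂ)) := by
  have hw2 : 1 + w ^ 2 = 2 * (w.re : ℂ) * w := by
    have h : w.re * w.re + w.im * w.im = 1 := by
      rw [← Complex.normSq_apply, Complex.normSq_eq_norm_sq, hw, one_pow]
    apply Complex.ext <;> simp [pow_two] <;> nlinarith
  induction n using Nat.twoStepInduction with
  | zero => simp [halaszPoly]
  | one =>
    have h3 : (α : ℂ) = w * (α * w.re - Complex.I * (α * w.im)) := by
      have h : w.re * w.re + w.im * w.im = 1 := by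
        rw [← Complex.normSq_apply, Complex.normSq_eq_norm_sq, hw, one_pow]
      apply Complex.ext <;> simp
      · linear_combination -α * h
      · ring
    simp [halaszPoly]
    exact h3
  | more n h0 h1 =>
    have hT : (T ℝ ((n + 2 : ℕ) : ℤ)).eval (α * w.re)
        = 2 * (α * w.re) * (T ℝ ((n + 1 : ℕ) : ℤ)).eval (α * w.re)
          - (T ℝ (n : ℤ)).eval (α * w.re) := by
      push_cast
      rw [T_add_two]; simp
    have hU : (U ℝ (((n + 2 : ℕ) : ℤ) - 1)).eval (α * w.re)
        = 2 * (α * w.re) * (U ℝ (((n + 1 : ℕ) : ℤ) - 1)).eval (α * w.re)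
          - (U ℝ ((n : ℤ) - 1)).eval (α * w.re) := by
      push_cast
      rw [show (n : ℤ) + 2 - 1 = (n - 1) + 2 by ring, U_add_two,
        show (n : ℤ) + 1 - 1 = n - 1 + 1 by ring]
      simp
    rw [halaszPoly, hT, hU]
    simp only [Polynomial.eval_sub, Polynomial.eval_mul, Polynomial.eval_C, Polynomial.eval_add,
      Polynomial.eval_one, Polynomial.eval_X, h0, h1, hw2]
    push_cast
    ring

/-- With `z = w²` and `x = α Re w`, one has `(α Im w)² ≤ 1 - x²`, so the squared modulus is at most
`T_n(x)² + (1 - x²) U_{n-1}(x)² = 1`. -/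
lemma norm_eval_halaszPoly_le {α : ℝ} (h0 : 0 ≤ α) (h1 : α ≤ 1) {z : ℂ} (hz : ‖z‖ = 1) (n : ℕ) :
    ‖(halaszPoly α n).eval z‖ ≤ 1 := by
  obtain ⟨w, rfl⟩ := IsAlgClosed.exists_pow_nat_eq z two_pos
  have hw : ‖w‖ = 1 := by
    rw [norm_pow] at hz
    exact (pow_eq_one_iff_of_nonneg (norm_nonneg _) two_ne_zero).1 hz
  have h : w.re * w.re + w.im * w.im = 1 := by
    rw [← Complex.normSq_apply, Complex.normSq_eq_norm_sq, hw, one_pow]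
  rw [eval_halaszPoly α hw, norm_mul, norm_pow, hw, one_pow, one_mul,
    ← sq_le_one_iff₀ (norm_nonneg _), ← Complex.normSq_eq_norm_sq]
  have hα : α ^ 2 ≤ 1 := pow_le_one₀ h0 h1
  have hx : (α * w.re) ^ 2 ≤ 1 := by nlinarith [sq_nonneg w.im, sq_nonneg w.re]
  have hx' := abs_le.1 ((sq_le_one_iff_abs_le_one _).1 hx)
  set φ := Real.arccos (α * w.re)
  have hφ : Real.cos φ = α * w.re := Real.cos_arccos hx'.1 hx'.2
  have hT := Polynomial.Chebyshev.T_real_cos φ n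
  have hU := Polynomial.Chebyshev.U_real_cos φ ((n : ℤ) - 1)
  rw [hφ] at hT hU
  have hsin : Real.sin φ ^ 2 = 1 - (α * w.re) ^ 2 := by
    rw [← hφ, Real.sin_sq]
  set u := (Polynomial.Chebyshev.U ℝ ((n : ℤ) - 1)).eval (α * w.re)
  have hU' : u ^ 2 * (1 - (α * w.re) ^ 2) = Real.sin (n * φ) ^ 2 := by
    rw [← hsin, ← mul_pow, hU]; push_cast; ring_nf
  rw [hT]
  simp only [Complex.normSq_apply, Complex.sub_re, Complex.sub_im, Complex.ofReal_re,
    Complex.ofReal_im, Complex.mul_re, Complex.mul_im, Complex.I_re, Complex.I_im]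
  have hc := Real.sin_sq_add_cos_sq (n * φ)
  push_cast
  have : (α * w.im) ^ 2 ≤ 1 - (α * w.re) ^ 2 := by nlinarith
  have := mul_le_mul_of_nonneg_left this (sq_nonneg u)
  nlinarith

/-- A polynomial of Halász type: normalized at `0`, vanishing at `1`, nearly bounded by `1`. -/
lemma exists_halaszPoly {m : ℕ} (hm : m ≠ 0) : ∃ Q : Polynomial ℂ, Q.natDegree ≤ m ∧
    Q.coeff 0 = 1 ∧ Q.eval 1 = 0 ∧ ∀ z : ℂ, ‖z‖ = 1 → ‖Q.eval z‖ ≤ Real.exp (2 / m) := by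
  have hm1 : (1 : ℝ) ≤ m := by exact_mod_cast Nat.one_le_iff_ne_zero.2 hm
  -- Chosen so that `T_{m+1}(cos θ) = cos (π/2) = 0`; at `w = 1` the other term vanishes with `Im
  -- w`.
  set θ : ℝ := Real.pi / (2 * (m + 1)) with hθ
  have hθ0 : 0 < θ := by positivity
  have hθ1 : θ * (m + 1) = Real.pi / 2 := by rw [hθ]; field_simp
  have hθ2 : θ < Real.pi / 2 := by nlinarith [Real.pi_pos]
  set α := Real.cos θ
  have hα0 : 0 < α := Real.cos_pos_of_mem_Ioo ⟨by linarith [Real.pi_pos], hθ2⟩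
  have hαC : (α : ℂ) ^ (m + 1) ≠ 0 := pow_ne_zero _ (by exact_mod_cast hα0.ne')
  -- This controls the cost of normalizing the constant term `α^(m+1)`: Bernoulli, with `cos θ ≥ 1 -
  -- θ²/2` and `π² < 10`.
  have hpow : Real.exp (-(2 / m)) ≤ α ^ (m + 1) := by
    have h1 : 1 - θ ^ 2 / 2 ≤ α := Real.one_sub_sq_div_two_le_cos
    have hpi : Real.pi ^ 2 < 10 := by nlinarith [Real.pi_lt_d2, Real.pi_pos]
    have hθs : (θ * (m + 1)) ^ 2 < 5 / 2 := by rw [hθ1]; nlinarith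
    have hmθ : (m + 1) * (θ ^ 2 / 2) ≤ 5 / 4 / (m + 1) := by
      rw [le_div_iff₀ (by positivity)]; nlinarith
    have h2 : 1 - 5 / 4 / (m + 1) ≤ α ^ (m + 1) := by
      have hb := one_add_mul_le_pow (show (-2 : ℝ) ≤ -(1 - α) by linarith) (m + 1)
      push_cast at hb
      rw [show 1 + -(1 - α) = α by ring] at hb
      nlinarith
    have h3 : Real.exp (-(2 / m)) ≤ m / (m + 2) := by
      rw [Real.exp_neg, inv_le_comm₀ (Real.exp_pos _) (by positivity), inv_div]
      have := Real.add_one_le_exp (2 / (m : ℝ))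
      calc ((m : ℝ) + 2) / m = 2 / m + 1 := by field_simp; ring
        _ ≤ _ := this
    have h4 : (m : ℝ) / (m + 2) ≤ 1 - 5 / 4 / (m + 1) := by
      rw [div_div, one_sub_div (by positivity), div_le_div_iff₀ (by positivity) (by positivity)]
      nlinarith
    linarith
  refine ⟨Polynomial.C ((α : ℂ) ^ (m + 1))⁻¹ * halaszPoly α (m + 1), ?_, ?_, ?_, fun z hz => ?_⟩
  · exact (Polynomial.natDegree_C_mul_le _ _).trans (natDegree_halaszPoly_succ_le α m)
  · rw [Polynomial.coeff_C_mul, coeff_zero_halaszPoly, inv_mul_cancel₀ hαC]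
  · have h := eval_halaszPoly α (w := 1) (by simp) (m + 1)
    have hT : (Polynomial.Chebyshev.T ℝ ((m + 1 : ℕ) : ℤ)).eval α = 0 := by
      rw [Polynomial.Chebyshev.T_real_cos]
      push_cast
      rw [mul_comm, hθ1, Real.cos_pi_div_two]
    rw [one_pow] at h
    rw [Polynomial.eval_mul, h]
    simp only [Complex.one_re, mul_one, hT]
    simp
  · have h := norm_eval_halaszPoly_le hα0.le (Real.cos_le_one θ) hz (m + 1)
    rw [Polynomial.eval_mul, Polynomial.eval_C, norm_mul, norm_inv, norm_pow, Complex.norm_real,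
      Real.norm_of_nonneg hα0.le]
    calc (α ^ (m + 1))⁻¹ * ‖(halaszPoly α (m + 1)).eval z‖ ≤ (α ^ (m + 1))⁻¹ :=
          mul_le_of_le_one_right (by positivity) h
      _ ≤ (Real.exp (-(2 / m)))⁻¹ := inv_anti₀ (Real.exp_pos _) hpow
      _ = _ := by rw [Real.exp_neg, inv_inv]

lemma exists_polynomial_vanishing {n k : ℕ} (hk : k ≠ 0) (hkn : k ≤ n) (z : ℕ → Circle) :
    ∃ P : Polynomial ℂ, P.natDegree ≤ n ∧ P.coeff 0 = 1 ∧
      (∀ t : Circle, ‖P.eval (t : ℂ)‖ ^ 2 ≤ Real.exp (8 * k ^ 2 / n)) ∧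
      ∀ i < k, ‖P.eval (z i : ℂ)‖ ^ 2 ≤ 0 := by
  have hm : n / k ≠ 0 := (Nat.div_pos hkn (Nat.pos_of_ne_zero hk)).ne'
  obtain ⟨Q, hdeg, h0, h1, hQ⟩ := exists_halaszPoly hm
  have heval : ∀ x : ℂ, (∏ i ∈ Finset.range k,
      Q.comp (Polynomial.C ((z i)⁻¹ : ℂ) * Polynomial.X)).eval x
        = ∏ i ∈ Finset.range k, Q.eval ((z i : ℂ)⁻¹ * x) := by
    intro x
    simp [Polynomial.eval_prod]
  refine ⟨∏ i ∈ Finset.range k, Q.comp (Polynomial.C ((z i)⁻¹ : ℂ) * Polynomial.X),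
    ?_, ?_, fun t => ?_, fun i hi => ?_⟩
  · refine (Polynomial.natDegree_prod_le _ _).trans ?_
    calc _ ≤ ∑ i ∈ Finset.range k, n / k := Finset.sum_le_sum fun i _ => by
          refine Polynomial.natDegree_comp_le.trans ?_
          calc _ ≤ n / k * 1 := Nat.mul_le_mul hdeg (by compute_degree)
            _ = n / k := mul_one _
      _ ≤ n := by
        rw [Finset.sum_const, Finset.card_range, smul_eq_mul]
        exact Nat.mul_div_le n k
  · rw [Polynomial.coeff_zero_eq_eval_zero, heval]
    simp [← Polynomial.coeff_zero_eq_eval_zero, h0]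
  · rw [heval, norm_prod]
    have hb : ∏ i ∈ Finset.range k, ‖Q.eval ((z i : ℂ)⁻¹ * t)‖
        ≤ ∏ i ∈ Finset.range k, Real.exp (2 / (n / k : ℕ)) :=
      Finset.prod_le_prod (fun _ _ => norm_nonneg _) fun i _ => hQ _ (by simp [Circle.norm_coe])
    rw [Finset.prod_const, Finset.card_range, ← Real.exp_nat_mul] at hb
    refine (pow_le_pow_left₀ (Finset.prod_nonneg fun _ _ => norm_nonneg _) hb 2).trans ?_
    rw [← Real.exp_nat_mul, Real.exp_le_exp]
    have hm0 : (0 : ℝ) < (n / k : ℕ) := by exact_mod_cast Nat.pos_of_ne_zero hm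
    have hn0 : (0 : ℝ) < n := by
      exact_mod_cast (Nat.pos_of_ne_zero hk).trans_le hkn
    -- As `n / k ≥ 1`, rounding down loses at most a factor `2`, so `2 · k · 2/⌊n/k⌋ ≤ 8k²/n`; this
    -- is the origin of the `1/8` in (iii).
    have hlt : (n : ℝ) ≤ 2 * (k * (n / k : ℕ)) := by
      have := Nat.div_add_mod n k
      have := Nat.mod_lt n (Nat.pos_of_ne_zero hk)
      have : k * 1 ≤ k * (n / k) := Nat.mul_le_mul_left k (Nat.one_le_iff_ne_zero.2 hm)
      have : n ≤ 2 * (k * (n / k)) := by omega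
      exact_mod_cast this
    push_cast
    rw [← mul_assoc, ← mul_div_assoc, div_le_div_iff₀ hm0 hn0]
    have hk0 : (0 : ℝ) ≤ k := k.cast_nonneg
    nlinarith
  · rw [heval, Finset.prod_eq_zero (Finset.mem_range.2 hi)]
    · simp
    · rw [inv_mul_cancel₀ (z i).coe_ne_zero, h1]

theorem eStar_sq_le_rpow {σ : ℝ} {a : ℕ+ → ℝ} (ha : IsWeightSeq a) {n k : ℕ} (hkn : k ≤ n)
    (h : (k : ℝ) ^ 2 * |Real.log (tail a k)|⁻¹ ≤ 1 / 8 * σ * n) :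
    eStar n a ^ 2 ≤ tail a k ^ (1 - σ) := by
  rcases eq_or_ne k 0 with rfl | hk
  · have h1 : tail a 0 = 1 := by simpa using (tail_add_sum ha 0).2
    rw [h1, Real.one_rpow]
    exact eStar_sq_le_one ha
  have hpos := tail_pos ha k
  have hlog : Real.log (tail a k) < 0 := Real.log_neg hpos (tail_lt_one ha hk)
  have hn0 : (0 : ℝ) < n := by
    exact_mod_cast (Nat.pos_of_ne_zero hk).trans_le hkn
  refine (eStar_sq_le_of_polynomials ha le_rfl (Real.exp_pos _).le
    (exists_polynomial_vanishing hk hkn)).trans ?_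
  rw [zero_add]
  -- The hypothesis says precisely that the bound `M = exp (8k²/n)` is at most `s_k^(-σ)`.
  have h2 : 8 * (k : ℝ) ^ 2 / n ≤ -σ * Real.log (tail a k) := by
    rw [abs_of_neg hlog, ← div_eq_mul_inv, div_le_iff₀ (by linarith)] at h
    rw [div_le_iff₀ hn0]
    linarith
  calc _ ≤ Real.exp (-σ * Real.log (tail a k)) * tail a k :=
        mul_le_mul_of_nonneg_right (Real.exp_le_exp.2 h2) hpos.le
    _ = _ := by
      rw [sub_eq_neg_add, Real.rpow_add hpos, Real.rpow_one, Real.rpow_def_of_pos hpos, mul_comm (-σ)]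

/-! ### Polynomial approximation through the Poisson kernel -/

lemma norm_circleAverage_le {F : ℂ → ℂ} {g : ℂ → ℝ} {R : ℝ} (hR : 0 ≤ R)
    (hg : CircleIntegrable g 0 R) (h : ∀ ζ, ‖ζ‖ = R → ‖F ζ‖ ≤ g ζ) :
    ‖Real.circleAverage F 0 R‖ ≤ Real.circleAverage g 0 R := by
  rw [Real.circleAverage_def, Real.circleAverage_def, norm_smul, smul_eq_mul,
    Real.norm_of_nonneg (by positivity)]
  refine mul_le_mul_of_nonneg_left ?_ (by positivity)
  refine intervalIntegral.norm_integral_le_of_norm_le (by positivity)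
    (.of_forall fun t _ => h _ ?_) hg
  simp [circleMap, abs_of_nonneg hR]

/-- On these circles `conj ζ = R²/ζ` and `conj z = 1/z`, so the kernel is rational in `ζ`; the
second fraction is analytic in the disc and vanishes at `0`. -/
lemma ofReal_poissonKernel_eq {R : ℝ} {z ζ : ℂ} (hR : 1 < R) (hz : ‖z‖ = 1) (hζ : ‖ζ‖ = R) :
    (poissonKernel 0 z ζ : ℂ) = ζ / (ζ - z) + ζ / (R ^ 2 * z - ζ) := by
  have hz0 : z ≠ 0 := norm_pos_iff.1 (by rw [hz]; exact one_pos)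
  have hζ0 : ζ ≠ 0 := norm_pos_iff.1 (by rw [hζ]; linarith)
  have hzz : z * (starRingEnd ℂ) z = 1 := by simp [Complex.mul_conj', hz]
  have hζζ : ζ * (starRingEnd ℂ) ζ = R ^ 2 := by simp [Complex.mul_conj', hζ]
  have h1 : ζ - z ≠ 0 := fun h => by
    rw [sub_eq_zero] at h; rw [h, hz] at hζ; linarith
  have h2 : (R : ℂ) ^ 2 * z - ζ ≠ 0 := fun h => by
    rw [sub_eq_zero] at h
    have := congrArg norm h
    rw [norm_mul, hz, hζ, norm_pow, Complex.norm_real, Real.norm_of_nonneg (by linarith)] at this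
    nlinarith
  have h3 : ((‖ζ - z‖ : ℂ)) ^ 2 = (ζ - z) * (R ^ 2 * z - ζ) / (ζ * z) := by
    rw [← Complex.mul_conj', map_sub, eq_div_iff (mul_ne_zero hζ0 hz0)]
    linear_combination (ζ - z) * (z * hζζ - ζ * hzz)
  rw [poissonKernel_def]
  push_cast
  simp only [sub_zero, hz, hζ]
  rw [h3]
  push_cast
  field_simp
  ring

/-- Decomposition of the Poisson kernel modulo functions of `ζ` analytic in the disc. -/
lemma poissonKernel_mul_one_sub_pow {R : ℝ} {z ζ : ℂ} (hR : 1 < R) (hz : ‖z‖ = 1)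
    (hζ : ‖ζ‖ = R) (N : ℕ) :
    (poissonKernel 0 z ζ : ℂ) * (1 - (z / ζ) ^ N) =
      ∑ j ∈ Finset.range N, (1 - ((R : ℂ) ^ 2)⁻¹ ^ (N - j)) * (z / ζ) ^ j
        + (1 - ((R : ℂ) ^ 2)⁻¹ ^ N) * (ζ / (R ^ 2 * z - ζ)) := by
  have hz0 : z ≠ 0 := norm_pos_iff.1 (by rw [hz]; exact one_pos)
  have hζ0 : ζ ≠ 0 := norm_pos_iff.1 (by rw [hζ]; linarith)
  have hR0 : (R : ℂ) ≠ 0 := by exact_mod_cast (by linarith : R ≠ 0)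
  have h1 : ζ - z ≠ 0 := fun h => by
    rw [sub_eq_zero] at h; rw [h, hz] at hζ; linarith
  have h2 : (R : ℂ) ^ 2 * z - ζ ≠ 0 := fun h => by
    rw [sub_eq_zero] at h
    have := congrArg norm h
    rw [norm_mul, hz, hζ, norm_pow, Complex.norm_real, Real.norm_of_nonneg (by linarith)] at this
    nlinarith
  rw [ofReal_poissonKernel_eq hR hz hζ]
  induction N with
  | zero => simp
  | succ N ih =>
    have hs : ∑ j ∈ Finset.range (N + 1), (1 - ((R : ℂ) ^ 2)⁻¹ ^ (N + 1 - j)) * (z / ζ) ^ j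
        = (1 - ((R : ℂ) ^ 2)⁻¹ ^ (N + 1))
          + z / ζ * ∑ j ∈ Finset.range N, (1 - ((R : ℂ) ^ 2)⁻¹ ^ (N - j)) * (z / ζ) ^ j := by
      rw [Finset.sum_range_succ', Finset.mul_sum, add_comm]
      congr 1
      · simp
      · refine Finset.sum_congr rfl fun j _ => ?_
        rw [Nat.add_sub_add_right]; ring
    rw [hs]
    rw [← sub_eq_iff_eq_add] at ih
    rw [← ih, pow_succ (z / ζ), pow_succ (((R : ℂ) ^ 2)⁻¹)]
    have hp : ζ / (ζ - z) * (1 - z / ζ) = 1 := by field_simp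
    have hq : ζ / (R ^ 2 * z - ζ) * (((R : ℂ) ^ 2)⁻¹ - z / ζ) = -((R : ℂ) ^ 2)⁻¹ := by
      rw [div_mul_eq_mul_div, div_eq_iff h2]
      field_simp
      ring
    linear_combination hp + (((R : ℂ) ^ 2)⁻¹) ^ N * hq

/-- A function bounded by `B` in the disc of radius `R > 1` is approximated on the unit circle by
a polynomial of degree at most `n` with error `B R⁻⁽ⁿ⁺¹⁾`. -/
lemma exists_polynomial_approx {f : ℂ → ℂ} {R r B : ℝ} (hR : 1 < R) (hr : R < r)
    (hf : DifferentiableOn ℂ f (Metric.ball 0 r)) (hB : ∀ ζ, ‖ζ‖ = R → ‖f ζ‖ ≤ B) (n : ℕ) :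
    ∃ P : Polynomial ℂ, P.natDegree ≤ n ∧
      P.coeff 0 = (1 - ((R : ℂ) ^ 2)⁻¹ ^ (n + 1)) * f 0 ∧
      ∀ z : ℂ, ‖z‖ = 1 → ‖f z - P.eval z‖ ≤ B * R⁻¹ ^ (n + 1) := by
  have hR0 : 0 < R := by linarith
  have hfc : DifferentiableOn ℂ f (Metric.closedBall 0 R) :=
    hf.mono (Metric.closedBall_subset_ball hr)
  have hfb : DiffContOnCl ℂ f (Metric.ball 0 R) := by
    refine DifferentiableOn.diffContOnCl ?_
    rw [closure_ball _ hR0.ne']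
    exact hfc
  have hfs : ContinuousOn f (Metric.sphere 0 R) :=
    hfc.continuousOn.mono Metric.sphere_subset_closedBall
  have hmean : ∀ h : ℂ → ℂ, DifferentiableOn ℂ h (Metric.closedBall 0 R) →
      Real.circleAverage h 0 R = h 0 := by
    intro h hh
    have : DiffContOnCl ℂ h (Metric.ball 0 |R|) := by
      refine DifferentiableOn.diffContOnCl ?_
      rwa [abs_of_pos hR0, closure_ball _ hR0.ne']
    exact this.circleAverage
  -- The `c j` are the Taylor coefficients of `f`, damped by `w j`. Unlike Cauchy estimates on the
  -- plain Taylor remainder, this avoids a factor of order `1/(R - 1)`.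
  set c : ℕ → ℂ := fun j => Real.circleAverage (fun ζ => (ζ ^ j)⁻¹ * f ζ) 0 R
  set w : ℕ → ℂ := fun j => 1 - ((R : ℂ) ^ 2)⁻¹ ^ (n + 1 - j)
  have hζ0 : ∀ ζ ∈ Metric.sphere (0 : ℂ) R, ζ ≠ 0 := fun ζ hζ h => by
    rw [h] at hζ; simp at hζ; linarith
  refine ⟨∑ j ∈ Finset.range (n + 1), Polynomial.C (w j * c j) * Polynomial.X ^ j,
    ?_, ?_, fun z hz => ?_⟩
  · refine Polynomial.natDegree_sum_le_of_forall_le _ _ fun j hj => ?_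
    exact (Polynomial.natDegree_C_mul_X_pow_le _ _).trans
      (Nat.lt_succ_iff.1 (Finset.mem_range.1 hj))
  · rw [Polynomial.coeff_zero_eq_eval_zero, Polynomial.eval_finsetSum,
      Finset.sum_eq_single_of_mem 0 (by simp)]
    · simp [w, c, hmean f hfc]
    · intro j _ hj
      simp [hj]
  have hzb : z ∈ Metric.ball (0 : ℂ) R := by simpa [hz] using hR
  have hpc : ContinuousOn (poissonKernel 0 z) (Metric.sphere 0 R) := by
    have h : ∀ ζ ∈ Metric.sphere (0 : ℂ) R, ‖ζ - 0 - (z - 0)‖ ^ 2 ≠ 0 := by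
      intro ζ hζ h
      have h : ζ = z := by simpa [sub_eq_zero] using h
      rw [h, mem_sphere_zero_iff_norm, hz] at hζ
      linarith
    exact ContinuousOn.div (by fun_prop) (by fun_prop) h
  have hpc' : ContinuousOn (fun ζ => (poissonKernel 0 z ζ : ℂ)) (Metric.sphere 0 R) :=
    Complex.continuous_ofReal.comp_continuousOn hpc
  have hP : Real.circleAverage (fun ζ => (poissonKernel 0 z ζ : ℂ) * f ζ) 0 R = f z := by
    rw [← hfb.circleAverage_poissonKernel_smul hzb]
    congr 1
  have hden : ∀ ζ ∈ Metric.closedBall (0 : ℂ) R, (R : ℂ) ^ 2 * z - ζ ≠ 0 := fun ζ hζ h => by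
    rw [mem_closedBall_zero_iff] at hζ
    rw [sub_eq_zero] at h
    have := congrArg norm h
    rw [norm_mul, hz, norm_pow, Complex.norm_real, Real.norm_of_nonneg (by linarith)] at this
    nlinarith
  -- Mean value property: the integrand is analytic and vanishes at the centre.
  have hg : Real.circleAverage (fun ζ => w 0 * (ζ / (R ^ 2 * z - ζ)) * f ζ) 0 R = 0 := by
    rw [hmean]
    · simp
    · refine DifferentiableOn.mul (DifferentiableOn.const_mul ?_ _) hfc
      exact differentiableOn_id.div (by fun_prop) hden
  -- Multiplying the kernel by `1 - (z/ζ)^(n+1)` turns Poisson's formula into the polynomial; the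
  -- omitted part is the error. It is small because the kernel is positive with mean `1` and `|z/ζ|
  -- = R⁻¹`.
  have hsplit : f z - (∑ j ∈ Finset.range (n + 1),
        Polynomial.C (w j * c j) * Polynomial.X ^ j).eval z
      = Real.circleAverage
          (fun ζ => (poissonKernel 0 z ζ : ℂ) * (z / ζ) ^ (n + 1) * f ζ) 0 R := by
    have hcj : ∀ j : ℕ, ContinuousOn (fun ζ : ℂ => (ζ ^ j)⁻¹ * f ζ) (Metric.sphere 0 R) :=
      fun j => ((continuousOn_pow j).inv₀ fun ζ hζ => pow_ne_zero _ (hζ0 ζ hζ)).mul hfs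
    have hev : (∑ j ∈ Finset.range (n + 1), Polynomial.C (w j * c j) * Polynomial.X ^ j).eval z
        = Real.circleAverage (fun ζ => ∑ j ∈ Finset.range (n + 1),
            (w j * z ^ j) • ((ζ ^ j)⁻¹ * f ζ)) 0 R := by
      rw [Real.circleAverage_fun_sum]
      · rw [Polynomial.eval_finsetSum]
        refine Finset.sum_congr rfl fun j _ => ?_
        rw [Real.circleAverage_fun_smul]
        simp only [Polynomial.eval_mul, Polynomial.eval_C, Polynomial.eval_pow, Polynomial.eval_X,
          smul_eq_mul, c]
        ring
      · intro j _
        refine ContinuousOn.circleIntegrable hR0.le ?_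
        exact (hcj j).const_smul (w j * z ^ j)
    have hsumc : ContinuousOn (fun ζ : ℂ => ∑ j ∈ Finset.range (n + 1),
        (w j * z ^ j) • ((ζ ^ j)⁻¹ * f ζ)) (Metric.sphere 0 R) :=
      continuousOn_finsetSum _ fun j _ => (hcj j).const_smul (w j * z ^ j)
    have hgc : ContinuousOn (fun ζ : ℂ => w 0 * (ζ / (R ^ 2 * z - ζ)) * f ζ)
        (Metric.sphere 0 R) := by
      refine ContinuousOn.mul (ContinuousOn.mul continuousOn_const ?_) hfs
      exact continuousOn_id.div (by fun_prop)
        fun ζ hζ => hden ζ (Metric.sphere_subset_closedBall hζ)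
    have hpf : ContinuousOn (fun ζ => (poissonKernel 0 z ζ : ℂ) * f ζ) (Metric.sphere 0 R) :=
      hpc'.mul hfs
    have hsub := Real.circleAverage_fun_sub (hpf.circleIntegrable hR0.le)
      (hsumc.circleIntegrable hR0.le)
    have hsub' := Real.circleAverage_fun_sub ((hpf.sub hsumc).circleIntegrable hR0.le)
      (hgc.circleIntegrable hR0.le)
    rw [hg, sub_zero] at hsub'
    rw [hev, ← hP, ← hsub]
    refine hsub'.symm.trans ?_
    refine Real.circleAverage_congr_sphere fun ζ hζ => ?_
    rw [abs_of_pos hR0, mem_sphere_zero_iff_norm] at hζ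
    have := poissonKernel_mul_one_sub_pow hR hz hζ (n + 1)
    have hsum : ∑ j ∈ Finset.range (n + 1), (w j * z ^ j) • ((ζ ^ j)⁻¹ * f ζ)
        = (∑ j ∈ Finset.range (n + 1), w j * (z / ζ) ^ j) * f ζ := by
      rw [Finset.sum_mul]
      refine Finset.sum_congr rfl fun j _ => ?_
      rw [smul_eq_mul, div_pow]; ring
    simp only [Pi.sub_apply, hsum, w, Nat.sub_zero]
    linear_combination f ζ * this
  rw [hsplit]
  have hone : Real.circleAverage (fun ζ => B * R⁻¹ ^ (n + 1) * poissonKernel 0 z ζ) 0 R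
      = B * R⁻¹ ^ (n + 1) := by
    have h := (InnerProductSpace.HarmonicOnNhd.circleAverage_poissonKernel_smul 
      (f := fun _ : ℂ => B * R⁻¹ ^ (n + 1)) (c := 0) (R := R) (w := z)
      (InnerProductSpace.harmonicOnNhd_const _) hzb)
    refine Eq.trans (congrArg (fun g => Real.circleAverage g 0 R) ?_) h
    funext ζ
    simp only [Pi.smul_apply', smul_eq_mul]
    ring
  rw [← hone]
  refine norm_circleAverage_le hR0.le ?_ fun ζ hζ => ?_
  · exact (hpc.const_smul (B * R⁻¹ ^ (n + 1))).circleIntegrable hR0.le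
  · have hp : 0 ≤ poissonKernel 0 z ζ := by
      rw [poissonKernel_def]
      simp only [sub_zero, hz, hζ]
      exact div_nonneg (by nlinarith) (by positivity)
    rw [norm_mul, norm_mul, Complex.norm_real, Real.norm_of_nonneg hp, norm_pow, norm_div, hz, hζ,
      one_div]
    have := hB ζ hζ
    have : 0 ≤ R⁻¹ ^ (n + 1) := by positivity
    calc _ ≤ poissonKernel 0 z ζ * R⁻¹ ^ (n + 1) * B := by gcongr
      _ = _ := by ring

/-! ### Outer functions and the bound with small values -/

lemma re_herglotz_nonneg {r : ℝ} {l ζ : ℂ} (hl : ‖l‖ = 1) (hζ : ‖ζ‖ < r) :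
    0 ≤ ((r * l + ζ) / (r * l - ζ)).re := by
  have hr : 0 < r := (norm_nonneg _).trans_lt hζ
  rw [Complex.div_re, ← add_div]
  refine div_nonneg ?_ (Complex.normSq_nonneg _)
  have h1 : l.re * l.re + l.im * l.im = 1 := by
    rw [← Complex.normSq_apply, Complex.normSq_eq_norm_sq, hl, one_pow]
  have h2 : ζ.re * ζ.re + ζ.im * ζ.im ≤ r ^ 2 := by
    rw [← Complex.normSq_apply, Complex.normSq_eq_norm_sq]
    exact pow_le_pow_left₀ (norm_nonneg _) hζ.le 2
  simp
  nlinarith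

/-- An outer function which is small at `k` given points of the circle. -/
lemma exists_analytic_small_at {k : ℕ} (hk : k ≠ 0) {A δ : ℝ} (hA : 0 ≤ A) (hδ : 0 < δ)
    (z : ℕ → Circle) : ∃ f : ℂ → ℂ, DifferentiableOn ℂ f (Metric.ball 0 (1 + 2 * δ)) ∧
      f 0 = 1 ∧ (∀ ζ, ‖ζ‖ < 1 + 2 * δ → ‖f ζ‖ ≤ Real.exp A) ∧
      ∀ i < k, ‖f (z i)‖ ≤ Real.exp (A - A / (k * δ)) := by
  set r : ℝ := 1 + 2 * δ with hr
  have hk0 : (0 : ℝ) < k := by exact_mod_cast Nat.pos_of_ne_zero hk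
  have hkC : (k : ℂ) ≠ 0 := by exact_mod_cast hk
  have hr0 : 0 < r := by positivity
  have hrC : (r : ℂ) ≠ 0 := by exact_mod_cast hr0.ne'
  have hden : ∀ i, ∀ ζ ∈ Metric.ball (0 : ℂ) r, (r : ℂ) * z i - ζ ≠ 0 := by
    intro i ζ hζ h
    rw [mem_ball_zero_iff] at hζ
    rw [sub_eq_zero] at h
    rw [← h, norm_mul, Circle.norm_coe, Complex.norm_real, Real.norm_of_nonneg hr0.le] at hζ
    linarith
  -- Herglotz kernels with poles at `r z_i`, just outside the circle: `Re S ≥ 0`, `S 0 = k`, and the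
  -- `i`-th term alone equals `(1 + δ)/δ` at `z_i`.
  set S : ℂ → ℂ := fun ζ => ∑ i ∈ Finset.range k, (r * z i + ζ) / (r * z i - ζ)
  have hnorm : ∀ ζ, ‖Complex.exp (A * (1 - S ζ / k))‖ = Real.exp (A - A / k * (S ζ).re) := by
    intro ζ
    rw [Complex.norm_exp, Complex.re_ofReal_mul, Complex.sub_re, Complex.div_natCast_re,
      Complex.one_re]
    congr 1
    field_simp
  have hre : ∀ ζ, (S ζ).re = ∑ i ∈ Finset.range k, (((r : ℂ) * (z i : ℂ) + ζ) / (r * (z i : ℂ) - ζ)).re :=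
    fun ζ => Complex.re_sum _ _
  refine ⟨fun ζ => Complex.exp (A * (1 - S ζ / k)), ?_, ?_, fun ζ hζ => ?_, fun i hi => ?_⟩
  · refine (DifferentiableOn.const_mul ((differentiableOn_const 1).sub
      (DifferentiableOn.div_const ?_ _)) _).cexp
    exact DifferentiableOn.fun_sum fun i _ =>
      DifferentiableOn.div (by fun_prop) (by fun_prop) (hden i)
  · have : S 0 = k := by
      have h : ∀ i, ((r : ℂ) * (z i : ℂ) + 0) / (r * (z i : ℂ) - 0) = 1 := fun i => by
        rw [add_zero, sub_zero, div_self (mul_ne_zero hrC (z i).coe_ne_zero)]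
      simp only [S, h]
      simp
    dsimp only
    rw [this, div_self hkC]
    simp
  · rw [hnorm, Real.exp_le_exp, hre]
    have : 0 ≤ ∑ i ∈ Finset.range k, (((r : ℂ) * (z i : ℂ) + ζ) / (r * (z i : ℂ) - ζ)).re :=
      Finset.sum_nonneg fun i _ => re_herglotz_nonneg (Circle.norm_coe _) hζ
    have := mul_nonneg (div_nonneg hA hk0.le) this
    linarith
  · rw [hnorm, Real.exp_le_exp, hre]
    have hzi : ‖(z i : ℂ)‖ < r := by rw [Circle.norm_coe]; linarith
    have h1 := Finset.single_le_sum (s := Finset.range k)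
      (f := fun j => (((r : ℂ) * (z j : ℂ) + (z i : ℂ)) / (r * (z j : ℂ) - (z i : ℂ))).re)
      (fun j _ => re_herglotz_nonneg (Circle.norm_coe _) hzi) (Finset.mem_range.2 hi)
    have h2 : (((r : ℂ) * (z i : ℂ) + z i) / (r * (z i : ℂ) - z i)).re = (1 + δ) / δ := by
      have hr1 : r - 1 ≠ 0 := by rw [hr]; linarith
      have : (((r : ℂ) * (z i : ℂ) + z i) / (r * (z i : ℂ) - z i)) = (((r + 1) / (r - 1) : ℝ) : ℂ) := by
        have : (z i : ℂ) ≠ 0 := (z i).coe_ne_zero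
        rw [← add_one_mul, ← sub_one_mul, mul_div_mul_right _ _ this]
        push_cast
        rfl
      rw [this, Complex.ofReal_re, hr]
      field_simp
      ring
    have h3 : 1 / δ ≤ (1 + δ) / δ := by gcongr; linarith
    have h4 : A / (k * δ) = A / k * (1 / δ) := by field_simp
    rw [h4]
    have := mul_le_mul_of_nonneg_left ((h3.trans h2.ge).trans h1) (div_nonneg hA hk0.le)
    linarith

lemma inv_one_add_pow_le {δ L : ℝ} (h0 : 0 < δ) (h1 : δ ≤ 1) {N : ℕ} (h : L ≤ N * (δ / 2)) :
    (1 + δ)⁻¹ ^ N ≤ Real.exp (-L) := by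
  have h2 : (1 + δ)⁻¹ ≤ Real.exp (-(δ / 2)) := by
    have := Real.add_one_le_exp (-(δ / 2))
    refine le_trans ?_ this
    rw [inv_le_iff_one_le_mul₀ (by positivity)]
    nlinarith
  calc _ ≤ Real.exp (-(δ / 2)) ^ N := pow_le_pow_left₀ (by positivity) h2 N
    _ = Real.exp (-(N * (δ / 2))) := by rw [← Real.exp_nat_mul]; ring_nf
    _ ≤ _ := Real.exp_le_exp.2 (by linarith)

lemma exists_polynomial_small_at {n k : ℕ} (hk : k ≠ 0) {A L : ℝ} (hA : 0 < A) (hL : 1 ≤ L)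
    (hkL : 2 * A ≤ k * L) (h : k * L ^ 2 ≤ A * n) (z : ℕ → Circle) :
    ∃ P : Polynomial ℂ, P.natDegree ≤ n ∧ P.coeff 0 = 1 ∧
      (∀ t : Circle, ‖P.eval (t : ℂ)‖ ^ 2 ≤ 16 * Real.exp (2 * A)) ∧
      ∀ i < k, ‖P.eval (z i : ℂ)‖ ^ 2 ≤ 16 * Real.exp (2 * A) * Real.exp (-L) := by
  have hk0 : (0 : ℝ) < k := by exact_mod_cast Nat.pos_of_ne_zero hk
  -- This makes `A/(kδ) = L/2`, so `|f|² ≤ e^(2A) e^(-L)` at the points, while `nδ/2 = An/(kL) ≥ L`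
  -- is the hypothesis and makes the approximation error at most `e^A e^(-L)`.
  set δ := 2 * A / (k * L) with hδ
  have hδ0 : 0 < δ := by positivity
  have hδ1 : δ ≤ 1 := (div_le_one (by positivity)).2 hkL
  obtain ⟨f, hf, hf0, hfA, hfz⟩ := exists_analytic_small_at hk hA.le hδ0 z
  obtain ⟨P, hdeg, hP0, hP⟩ := exists_polynomial_approx (R := 1 + δ) (by linarith) (by linarith) hf
    (B := Real.exp A) (fun ζ hζ => hfA ζ (by rw [hζ]; linarith)) n
  set x : ℝ := (1 + δ)⁻¹ ^ (n + 1) with hx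
  have hx0 : 0 < x := by positivity
  have hxL : x ≤ Real.exp (-L) := by
    refine inv_one_add_pow_le hδ0 hδ1 ?_
    have : L ≤ n * (δ / 2) := by
      rw [hδ, show (n : ℝ) * (2 * A / (k * L) / 2) = A * n / (k * L) by field_simp,
        le_div_iff₀ (by positivity)]
      linarith
    push_cast
    nlinarith
  have hx1 : x ≤ 1 / 2 := by
    refine hxL.trans ((Real.exp_le_exp.2 (neg_le_neg hL)).trans ?_)
    rw [Real.exp_neg, one_div]
    exact inv_anti₀ two_pos (by linarith [Real.add_one_le_exp 1])
  have hc : P.coeff 0 = ((1 - x ^ 2 : ℝ) : ℂ) := by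
    rw [hP0, hf0, hx]
    push_cast
    rw [mul_one, ← inv_pow, ← pow_mul, ← pow_mul, mul_comm 2]
  -- Restoring the constant term `1` costs at most a factor `2`; together with the factor `2` from
  -- adding the two errors, squared, this gives `16`.
  have hcpos : 1 / 2 ≤ 1 - x ^ 2 := by nlinarith
  have hcne : ((1 - x ^ 2 : ℝ) : ℂ) ≠ 0 := by
    exact_mod_cast (by linarith : 1 - x ^ 2 ≠ 0)
  have heval : ∀ (t : Circle) (b : ℝ), ‖f t‖ + Real.exp A * x ≤ b →
      ‖(Polynomial.C ((1 - x ^ 2 : ℝ) : ℂ)⁻¹ * P).eval (t : ℂ)‖ ^ 2 ≤ (2 * b) ^ 2 := by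
    intro t b hb
    refine pow_le_pow_left₀ (norm_nonneg _) ?_ 2
    have h1 := hP t (Circle.norm_coe t)
    have h2 : ‖P.eval (t : ℂ)‖ ≤ b := by
      have := norm_sub_norm_le (P.eval (t : ℂ)) (f t)
      rw [norm_sub_rev] at this
      linarith
    rw [Polynomial.eval_mul, Polynomial.eval_C, norm_mul, norm_inv, Complex.norm_real,
      Real.norm_of_nonneg (by linarith)]
    refine mul_le_mul ?_ h2 (norm_nonneg _) two_pos.le
    rw [inv_le_comm₀ (by linarith) two_pos]
    linarith
  have hexp : Real.exp (2 * A) = Real.exp A ^ 2 := by rw [← Real.exp_nat_mul]; norm_num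
  have hexpL : Real.exp (-L) = Real.exp (-(L / 2)) ^ 2 := by
    rw [← Real.exp_nat_mul]; congr 1; push_cast; ring
  have hEA := Real.exp_pos A
  refine ⟨Polynomial.C ((1 - x ^ 2 : ℝ) : ℂ)⁻¹ * P, (Polynomial.natDegree_C_mul_le _ _).trans hdeg,
    ?_, fun t => ?_, fun i hi => ?_⟩
  · rw [Polynomial.coeff_C_mul, hc, inv_mul_cancel₀ hcne]
  · refine (heval t (2 * Real.exp A) ?_).trans (le_of_eq (by rw [hexp]; ring))
    have := hfA t (by rw [Circle.norm_coe]; linarith)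
    nlinarith
  · refine (heval (z i) (2 * (Real.exp A * Real.exp (-(L / 2)))) ?_).trans
      (le_of_eq (by rw [hexp, hexpL]; ring))
    have h1 : ‖f (z i)‖ ≤ Real.exp A * Real.exp (-(L / 2)) := by
      refine (hfz i hi).trans (le_of_eq ?_)
      rw [← Real.exp_add]
      congr 1
      rw [hδ]
      field_simp
      ring
    have h2 : x ≤ Real.exp (-(L / 2)) := hxL.trans (Real.exp_le_exp.2 (by linarith))
    nlinarith

/-- Since `e^(-L) = s_k`, both `η` and `M s_k` equal `16 e^(2A) s_k`. When `L < 1` or `kL < 2A`, the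
tail is bounded below and the trivial bound `1` suffices. -/
theorem eStar_sq_le_const_mul_tail {A p : ℝ} (hA : 0 < A) (hp : 2 ≤ p) {a : ℕ+ → ℝ}
    (ha : IsWeightSeq a) {n k : ℕ} (h : (k : ℝ) * |Real.log (tail a k)| ^ p ≤ A * n) :
    eStar n a ^ 2 ≤ 32 * Real.exp (2 * A) * tail a k := by
  have hs := tail_pos ha k
  set L := |Real.log (tail a k)|
  have hL : Real.exp (-L) = tail a k := by
    rw [show -L = Real.log (tail a k) by
      simp only [L]; rw [abs_of_nonpos (Real.log_nonpos hs.le (tail_le_one ha k)), neg_neg],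
      Real.exp_log hs]
  have hexp1 : 1 ≤ Real.exp (2 * A) := Real.one_le_exp (by linarith)
  by_cases hL1 : L < 1
  · refine (eStar_sq_le_one ha).trans ?_
    have h1 : 1 / 32 ≤ tail a k := by
      rw [← hL]
      have h2 := Real.exp_le_exp.2 (neg_le_neg hL1.le)
      have h3 : Real.exp 1 < 32 := by linarith [Real.exp_one_lt_d9]
      rw [Real.exp_neg 1] at h2
      have h4 := inv_anti₀ (Real.exp_pos 1) h3.le
      linarith
    nlinarith
  push Not at hL1
  by_cases hkL : (k : ℝ) * L < 2 * A
  · rcases eq_or_ne k 0 with rfl | hk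
    · refine (eStar_sq_le_one ha).trans ?_
      have h1 : tail a 0 = 1 := by simpa using (tail_add_sum ha 0).2
      rw [h1]
      linarith
    have hk1 : (1 : ℝ) ≤ k := by exact_mod_cast Nat.one_le_iff_ne_zero.2 hk
    refine (eStar_sq_le_one ha).trans ?_
    have h1 : L ≤ 2 * A := by nlinarith
    have h2 : 1 ≤ Real.exp (2 * A) * tail a k := by
      rw [← hL, ← Real.exp_add]
      exact Real.one_le_exp (by linarith)
    linarith
  push Not at hkL
  have hk : k ≠ 0 := by
    rintro rfl
    simp at hkL
    linarith
  -- Only the exponent `2` matters, because `L ≥ 1` here.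
  have hLp : L ^ 2 ≤ L ^ p := by
    rw [← Real.rpow_natCast]
    exact Real.rpow_le_rpow_of_exponent_le hL1 (by exact_mod_cast hp)
  have hkA : (k : ℝ) * L ^ 2 ≤ A * n :=
    (mul_le_mul_of_nonneg_left hLp k.cast_nonneg).trans h
  refine (eStar_sq_le_of_polynomials ha (by positivity) (by positivity)
    (exists_polynomial_small_at hk hA hL1 hkL hkA)).trans (le_of_eq ?_)
  rw [hL]
  ring

end SzegoMinimum

end

/-! ### Assembly of the three statements -/

theorem theorem3 :
    -- (i)
    (∀ a : ℕ+ → ℝ, SzegoMinimum.IsWeightSeq a → Antitone a → ∀ n : ℕ,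
      ((n : ℝ) + 1) * ∑' j : ℕ+, a (j * Nat.succPNat n) ≤ SzegoMinimum.eStar n a ^ 2 ∧
      ((n : ℝ) + 1) * a (Nat.succPNat n) ≤ SzegoMinimum.eStar n a ^ 2) ∧
    -- (ii)
    (∀ γ : ℝ, 0 < γ → γ < 1 → ∀ A : ℝ, 0 < A → ∃ C : ℝ, 0 < C ∧
      ∀ a : ℕ+ → ℝ, SzegoMinimum.IsWeightSeq a → ∀ n k : ℕ,
        (k : ℝ) * |Real.log (SzegoMinimum.tail a k)| ^ (1 + 1 / γ) ≤ A * (n : ℝ) →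
          SzegoMinimum.eStar n a ^ 2 ≤ C * SzegoMinimum.tail a k) ∧
    -- (iii)
    (∀ σ : ℝ, 0 < σ → σ ≤ 1 / 2 →
      ∀ a : ℕ+ → ℝ, SzegoMinimum.IsWeightSeq a → ∀ n k : ℕ, k ≤ n →
        (k : ℝ) ^ 2 * |Real.log (SzegoMinimum.tail a k)|⁻¹ ≤ 1 / 8 * σ * (n : ℝ) →
          SzegoMinimum.eStar n a ^ 2 ≤ SzegoMinimum.tail a k ^ (1 - σ)) := by
  refine ⟨fun a ha hanti n => ?_, fun γ hγ0 hγ1 A hA => ?_, fun σ _ _ a ha n k hkn h => ?_⟩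
  · have h := SzegoMinimum.le_eStar_sq_of_antitone ha hanti n
    refine ⟨h, le_trans ?_ h⟩
    exact mul_le_mul_of_nonneg_left (SzegoMinimum.le_tsum_multiples ha _) (by positivity)
  · have hp : (2 : ℝ) ≤ 1 + 1 / γ := by
      have := (one_le_div hγ0).2 hγ1.le
      linarith
    exact ⟨32 * Real.exp (2 * A), by positivity, fun a ha n k h =>
      SzegoMinimum.eStar_sq_le_const_mul_tail hA hp ha h⟩
  · exact SzegoMinimum.eStar_sq_le_rpow ha hkn h
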